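/- Let $\mathbb F\in\{\mathbb R,\mathbb C\}$, let $X$ be a compact metric space, and let $K\colon X\times X\to\mathbb F$ be a Mercer kernel, that is, $K$ is continuous, Hermitian ($K(y,x)=\overline{K(x,y)}$) and positive semidefinite ($\sum_{i,j}\overline{\alpha_i}\alpha_jK(x_i,x_j)\ge 0$ for all finite families $x_i\in X$, $\alpha_i\in\mathbb F$). Let $\mathcal H_K$ be the reproducing kernel Hilbert space of functions on $X$ with reproducing kernel $K$. Let $\nu$ be a finite Borel measure on $X$ with $\operatorname{supp}(\nu)\supseteq\operatorname{supp}(K)$, where $\operatorname{supp}(K)=\{x\in X : K(x,y)\ne0\text{ or }K(y,x)\neq 0\text{ for some }y\in X\}$. Let $L_K$ be the integral operator on $L^2(X,\nu)$ given by $(L_Kf)(x)=\int_XK(x,t)f(t)\,d\nu(t)$, let $\lambda_1\ge\lambda_2\ge\cdots>0$ be its (finitely or infinitely many) nonzero eigenvalues counted with multiplicity, and let $(\phi_n)_n$ be a corresponding orthonormal system of eigenfunctions, $\phi_n$ being taken as the continuous function with $\phi_n(x)=\lambda_n^{-1}\int_XK(x,t)\phi_n(t)\,d\nu(t)$ for every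 $x\in X$. Then every function in $\mathcal H_K$ is square integrable with respect to $\nu$ and is determined by its class in $L^2(X,\nu)$, and with this identification $$\mathcal H_K=\Bigl\{f\in L^2(X,\nu)\ :\ f=\sum_n f_n\phi_n,\ \bigl(f_n/\sqrt{\lambda_n}\bigr)_n\in\ell^2_{\mathbb F}\Bigr\},$$ where, for $f\in\mathcal H_K$, the series $\sum_n f_n\phi_n(x)$ converges to $f(x)$ absolutely and uniformly on $X$. In particular, as a set of functions on $X$, $\mathcal H_K$ consists of exactly the pointwise sums $f(x)=\sum_n f_n\phi_n(x)$, $x\in X$, with $(f_n/\sqrt{\lambda_n})_n\in\ell^2_{\mathbb F}$. -/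

import Mathlib

open MeasureTheory Set

open scoped ComplexOrder in
/-- A scalar kernel on a topological space is a Mercer kernel when it is (jointly) continuous,
Hermitian (symmetric over `ℝ`) and positive semidefinite. `Matrix.PosSemidef` for an arbitrary index
type says exactly that the kernel is Hermitian and that the finite sums
`∑ i, ∑ j, conj (α i) * K (x i) (x j) * α j` are nonnegative. -/
structure IsMercerKernel {𝕜 : Type*} [RCLike 𝕜] {X : Type*} [TopologicalSpace X]
    (K : X → X → 𝕜) : Prop where
  continuous_uncurry : Continuous (Function.uncurry K)
  posSemidef : (Matrix.of K).PosSemidef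

/-- The support of a kernel: all points `x` such that `K x y ≠ 0` or `K y x ≠ 0` for some `y`. -/
def kernelSupport {𝕜 : Type*} [RCLike 𝕜] {X : Type*} (K : X → X → 𝕜) : Set X :=
  {x | ∃ y, K x y ≠ 0 ∨ K y x ≠ 0}

section IntegralOperator

variable {𝕜 : Type*} [RCLike 𝕜] {X : Type*} [MetricSpace X] [CompactSpace X]
  [MeasurableSpace X] [BorelSpace X]

theorem integrable_kernel_mul (K : X → X → 𝕜) (hK : Continuous (Function.uncurry K))
    (ν : Measure X) [IsFiniteMeasure ν] (f : Lp 𝕜 2 ν) (x : X) :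
    Integrable (fun t => K x t * f t) ν := by
  have hc : Continuous (fun t => K x t) := hK.comp (by fun_prop : Continuous fun t => (x, t))
  obtain ⟨C, hC⟩ := (isCompact_range hK).isBounded.exists_norm_le
  refine ((Lp.memLp f).integrable one_le_two).bdd_mul (c := C) hc.aestronglyMeasurable
    (Filter.Eventually.of_forall fun t => hC _ ⟨(x, t), rfl⟩)

theorem continuous_integral_kernel_mul (K : X → X → 𝕜) (hK : Continuous (Function.uncurry K))
    (ν : Measure X) [IsFiniteMeasure ν] (f : Lp 𝕜 2 ν) :
    Continuous (fun x => ∫ t, K x t * f t ∂ν) := by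
  obtain ⟨C, hC⟩ := (isCompact_range hK).isBounded.exists_norm_le
  refine continuous_of_dominated (bound := fun t => C * ‖f t‖)
    (fun x => (integrable_kernel_mul K hK ν f x).aestronglyMeasurable)
    (fun x => Filter.Eventually.of_forall fun t => ?_)
    (((Lp.memLp f).integrable one_le_two).norm.const_mul C)
    (Filter.Eventually.of_forall fun t => ?_)
  · rw [norm_mul]
    exact mul_le_mul_of_nonneg_right (hC _ ⟨(x, t), rfl⟩) (norm_nonneg _)
  · exact (hK.comp (by fun_prop : Continuous fun x : X => (x, t))).mul continuous_const

/-- The integral operator `f ↦ ∫ t, K · t * f t ∂ν` with a continuous kernel, as a linear map from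
`L²(X, ν)` to the space of continuous functions on `X`. -/
noncomputable def integralOperatorC (K : X → X → 𝕜) (hK : Continuous (Function.uncurry K))
    (ν : Measure X) [IsFiniteMeasure ν] : Lp 𝕜 2 ν →ₗ[𝕜] C(X, 𝕜) where
  toFun f := ⟨fun x => ∫ t, K x t * f t ∂ν, continuous_integral_kernel_mul K hK ν f⟩
  map_add' f g := by
    ext x
    simp only [ContinuousMap.coe_mk, ContinuousMap.add_apply]
    rw [← integral_add (integrable_kernel_mul K hK ν f x) (integrable_kernel_mul K hK ν g x)]
    refine integral_congr_ae ?_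
    filter_upwards [Lp.coeFn_add f g] with t ht
    rw [ht, Pi.add_apply, mul_add]
  map_smul' a f := by
    ext x
    simp only [ContinuousMap.coe_mk, ContinuousMap.smul_apply, RingHom.id_apply, smul_eq_mul]
    rw [← integral_const_mul]
    refine integral_congr_ae ?_
    filter_upwards [Lp.coeFn_smul a f] with t ht
    rw [ht, Pi.smul_apply, smul_eq_mul]
    ring

/-- The integral operator `L_K : L²(X, ν) → L²(X, ν)` with a continuous kernel `K`. -/
noncomputable def integralOperator (K : X → X → 𝕜) (hK : Continuous (Function.uncurry K))
    (ν : Measure X) [IsFiniteMeasure ν] : Lp 𝕜 2 ν →ₗ[𝕜] Lp 𝕜 2 ν :=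
  (ContinuousMap.toLp 2 ν 𝕜 : C(X, 𝕜) →L[𝕜] Lp 𝕜 2 ν).toLinearMap ∘ₗ integralOperatorC K hK ν

/-- `lam` lists the nonzero eigenvalues of `L_K` in nonincreasing order, each repeated according to
its multiplicity (there are `N` of them, with `N` finite or infinite, indexed from `0`), and `φ` is a
corresponding orthonormal system of eigenfunctions. The eigenfunctions are the continuous functions
`φ n = (lam n)⁻¹ ∫ t, K · t * φ n t ∂ν`, so that the eigenvalue equation holds at every point. -/
structure IsMercerEigensystem (K : X → X → 𝕜) (hK : Continuous (Function.uncurry K))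
    (ν : Measure X) [IsFiniteMeasure ν] (N : ℕ∞) (lam : {n : ℕ // (n : ℕ∞) < N} → ℝ)
    (φ : {n : ℕ // (n : ℕ∞) < N} → C(X, 𝕜)) : Prop where
  pos : ∀ n, 0 < lam n
  antitone : Antitone lam
  multiplicity : ∀ μ : 𝕜, μ ≠ 0 → {n | ((lam n : ℝ) : 𝕜) = μ}.encard =
    (Module.finrank 𝕜 (Module.End.eigenspace (integralOperator K hK ν) μ) : ℕ∞)
  orthonormal : Orthonormal 𝕜 (fun n => ContinuousMap.toLp 2 ν 𝕜 (φ n))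
  eigen : ∀ n, integralOperatorC K hK ν (ContinuousMap.toLp 2 ν 𝕜 (φ n)) =
    ((lam n : ℝ) : 𝕜) • φ n

end IntegralOperator

/-! Let `J : H → L²` be the inclusion. The reproducing property gives `J J* = L_K`, and `J` factors
through a compact inclusion `H → C(X)`, so `L_K` is compact and symmetric. `J` is injective since
elements of `H` are continuous and vanish off the support of `K`. The vectors `v n = (√λ_n)⁻¹ J*
φ_n` are orthonormal in `H` and equal `√λ_n φ_n` as functions. If `h ⊥ v n` for all `n`, then `J h ⊥
φ_n`, so `J J* J h = 0` by the spectral theorem, whence `h = 0`. So they form a Hilbert basis, and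
its expansions pass through `H → C(X)` to uniform, pointwise and `L²` sums. -/

open scoped InnerProductSpace

/-! ### Compact symmetric operators and complete eigensystems -/

section Spectral

variable {𝕜 E ι : Type*} [RCLike 𝕜] [NormedAddCommGroup E] [InnerProductSpace 𝕜 E]
  [CompleteSpace E]

/-- A vector orthogonal to an orthonormal system of eigenvectors of a compact symmetric operator
which contains, for each nonzero eigenvalue, as many vectors as its multiplicity, lies in the kernel
of the operator. -/
theorem IsCompactOperator.apply_eq_zero_of_forall_inner_eigenvector_eq_zero {T : E →ₗ[𝕜] E}
    (hT : IsCompactOperator T) (hsymm : T.IsSymmetric) {v : ι → E} (hv : Orthonormal 𝕜 v)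
    {a : ι → 𝕜} (hva : ∀ i, T (v i) = a i • v i)
    (hcard : ∀ μ : 𝕜, μ ≠ 0 →
      {i | a i = μ}.encard = (Module.finrank 𝕜 (Module.End.eigenspace T μ) : ℕ∞))
    {f : E} (hf : ∀ i, ⟪v i, f⟫_𝕜 = 0) : T f = 0 := by
  -- The eigenspaces have dense span, so it suffices to test `T f` against eigenvectors.
  have hbot : (⨆ μ, Module.End.eigenspace T μ)ᗮ = ⊥ :=
    ContinuousLinearMap.orthogonalComplement_iSup_eigenspaces_eq_bot (T := ⟨T, hT.continuous⟩) hT hsymm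
  rw [← Submodule.mem_bot 𝕜, ← hbot, ← Submodule.iInf_orthogonal, Submodule.mem_iInf]
  intro μ
  rw [Submodule.mem_orthogonal]
  intro u hu
  rw [← hsymm u f, Module.End.mem_eigenspace_iff.mp hu, inner_smul_left]
  rcases eq_or_ne μ 0 with rfl | hμ
  · simp
  suffices h : ⟪u, f⟫_𝕜 = 0 by rw [h, mul_zero]
  have : FiniteDimensional 𝕜 (Module.End.eigenspace T μ) :=
    ContinuousLinearMap.finite_dimensional_eigenspace (T := ⟨T, hT.continuous⟩) hT μ hμ
  have hfin : {i | a i = μ}.Finite := by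
    rw [← Set.encard_lt_top_iff, hcard μ hμ]
    exact ENat.natCast_lt_top _
  have := hfin.fintype
  let w : {i | a i = μ} → Module.End.eigenspace T μ := fun i =>
    ⟨v i, Module.End.mem_eigenspace_iff.mpr (by rw [hva, i.2])⟩
  have hw : LinearIndependent 𝕜 w := by
    refine LinearIndependent.of_comp (Module.End.eigenspace T μ).subtype ?_
    exact hv.linearIndependent.comp _ Subtype.val_injective
  have hc : Fintype.card {i | a i = μ} = Module.finrank 𝕜 (Module.End.eigenspace T μ) := by
    have := hcard μ hμ
    rw [Set.encard_eq_coe_toFinset_card, Set.toFinset_card] at this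
    exact_mod_cast this
  -- An independent family with as many members as the dimension spans the eigenspace.
  have hspan := hw.span_eq_top_of_card_eq_finrank' hc
  have hle : Module.End.eigenspace T μ ≤ (𝕜 ∙ f)ᗮ := by
    intro x hx
    have hx' : (⟨x, hx⟩ : Module.End.eigenspace T μ) ∈ Submodule.span 𝕜 (range w) := by
      rw [hspan]; trivial
    have := Submodule.mem_map_of_mem (f := (Module.End.eigenspace T μ).subtype) hx'
    rw [Submodule.map_span] at this
    refine Submodule.span_le.mpr ?_ this
    rintro _ ⟨_, ⟨i, rfl⟩, rfl⟩
    exact Submodule.mem_orthogonal_singleton_iff_inner_left.mpr (hf i)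
  exact Submodule.mem_orthogonal_singleton_iff_inner_left.mp (hle hu)

end Spectral

/-! ### Continuity and compactness of the inclusion into `C(X)` -/

section RKHS

variable {𝕜 : Type*} [RCLike 𝕜] {X : Type*} {K : X → X → 𝕜}
  {H : Type*} [NormedAddCommGroup H] [InnerProductSpace 𝕜 H] [CompleteSpace H] [RKHS 𝕜 H X 𝕜]

theorem RKHS.inner_kerFun_one_left (x : X) (h : H) : ⟪RKHS.kerFun H x (1 : 𝕜), h⟫_𝕜 = h x := by
  rw [RKHS.kerFun_inner]
  simp

theorem RKHS.kerFun_one_apply (hH : ∀ x y, RKHS.kernel H x y 1 = K x y) (x y : X) :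
    RKHS.kerFun H y (1 : 𝕜) x = K x y := by
  rw [RKHS.kerFun_apply, hH]

theorem RKHS.apply_eq_zero_of_notMem_kernelSupport (hH : ∀ x y, RKHS.kernel H x y 1 = K x y)
    {x : X} (hx : x ∉ kernelSupport K) (h : H) : h x = 0 := by
  have hk : RKHS.kerFun H x (1 : 𝕜) = 0 := by
    ext y
    rw [RKHS.kerFun_one_apply hH, RKHS.coe_zero, Pi.zero_apply]
    by_contra hne
    exact hx ⟨y, Or.inr hne⟩
  rw [← RKHS.inner_kerFun_one_left, hk, inner_zero_left]

/-- By the reproducing property, the squared distance of two kernel functions is a combination of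
four values of `K`. -/
theorem RKHS.continuous_kerFun_one [TopologicalSpace X]
    (hH : ∀ x y, RKHS.kernel H x y 1 = K x y) (hK : Continuous (Function.uncurry K)) :
    Continuous fun x : X => RKHS.kerFun H x (1 : 𝕜) := by
  rw [continuous_iff_continuousAt]
  intro x
  rw [ContinuousAt, tendsto_iff_norm_sub_tendsto_zero]
  have hsq (y : X) : ‖RKHS.kerFun H y (1 : 𝕜) - RKHS.kerFun H x (1 : 𝕜)‖ =
      √(RCLike.re (K y y - K y x - K x y + K x x)) := by
    rw [norm_eq_sqrt_re_inner (𝕜 := 𝕜)]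
    simp only [inner_sub_left, inner_sub_right, RKHS.inner_kerFun_one_left,
      RKHS.kerFun_one_apply hH]
    congr 2
    ring
  simp_rw [hsq]
  have hc : Continuous fun y => √(RCLike.re (K y y - K y x - K x y + K x x)) := by
    have h1 : Continuous fun y => K y y := hK.comp (by fun_prop : Continuous fun y : X => (y, y))
    have h2 : Continuous fun y => K y x := hK.comp (by fun_prop : Continuous fun y : X => (y, x))
    have h3 : Continuous fun y => K x y := hK.comp (by fun_prop : Continuous fun y : X => (x, y))
    fun_prop
  simpa using hc.tendsto x

variable [TopologicalSpace X]

theorem RKHS.continuous_coe (hk : Continuous fun x : X => RKHS.kerFun H x (1 : 𝕜)) (h : H) :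
    Continuous (h : X → 𝕜) := by
  have he : (h : X → 𝕜) = fun x => ⟪RKHS.kerFun H x (1 : 𝕜), h⟫_𝕜 :=
    funext fun x => (RKHS.inner_kerFun_one_left x h).symm
  rw [he]
  fun_prop

theorem RKHS.exists_norm_kerFun_one_le [CompactSpace X]
    (hk : Continuous fun x : X => RKHS.kerFun H x (1 : 𝕜)) :
    ∃ C, 0 ≤ C ∧ ∀ x : X, ‖RKHS.kerFun H x (1 : 𝕜)‖ ≤ C := by
  obtain ⟨C, hC⟩ := (isCompact_range hk).isBounded.exists_norm_le
  exact ⟨max C 0, le_max_right _ _, fun x => (hC _ ⟨x, rfl⟩).trans (le_max_left _ _)⟩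

/-- The inclusion of a reproducing kernel Hilbert space on a compact space into the space of
continuous functions, when the kernel functions depend continuously on the point. -/
noncomputable def RKHS.toContinuousMap [CompactSpace X]
    (hk : Continuous fun x : X => RKHS.kerFun H x (1 : 𝕜)) : H →L[𝕜] C(X, 𝕜) :=
  LinearMap.mkContinuousOfExistsBound
    { toFun := fun h => ⟨h, RKHS.continuous_coe hk h⟩
      map_add' := fun f g => by ext x; simp
      map_smul' := fun a f => by ext x; simp }
    (by
      obtain ⟨C, hC0, hC⟩ := RKHS.exists_norm_kerFun_one_le hk
      refine ⟨C, fun h => (ContinuousMap.norm_le _ (by positivity)).mpr fun x => ?_⟩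
      change ‖h x‖ ≤ _
      rw [← RKHS.inner_kerFun_one_left]
      exact (norm_inner_le_norm _ _).trans (by gcongr; exact hC x))

@[simp]
theorem RKHS.toContinuousMap_apply [CompactSpace X]
    (hk : Continuous fun x : X => RKHS.kerFun H x (1 : 𝕜)) (h : H) (x : X) :
    RKHS.toContinuousMap hk h x = h x := rfl

/-- Arzelà–Ascoli: on the unit ball, Cauchy–Schwarz gives `|h x| ≤ ‖K_x‖` and `|h x - h y| ≤ ‖K_x -
K_y‖`, where `K_x` is the kernel function at `x`. -/
theorem RKHS.isCompactOperator_toContinuousMap [CompactSpace X]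
    (hk : Continuous fun x : X => RKHS.kerFun H x (1 : 𝕜)) :
    IsCompactOperator (RKHS.toContinuousMap hk) := by
  obtain ⟨C, hC0, hC⟩ := RKHS.exists_norm_kerFun_one_le hk
  let e := ContinuousMap.equivBoundedOfCompact X 𝕜
  let A : Set (BoundedContinuousFunction X 𝕜) :=
    (fun h => e (RKHS.toContinuousMap hk h)) '' Metric.closedBall (0 : H) 1
  have hA : IsCompact (closure A) := by
    refine BoundedContinuousFunction.arzela_ascoli (Metric.closedBall (0 : 𝕜) C)
      (isCompact_closedBall _ _) A ?_ ?_
    · rintro _ x ⟨h, hh, rfl⟩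
      rw [mem_closedBall_zero_iff] at hh ⊢
      change ‖h x‖ ≤ C
      rw [← RKHS.inner_kerFun_one_left]
      refine (norm_inner_le_norm _ _).trans ?_
      nlinarith [hC x, norm_nonneg h, norm_nonneg (RKHS.kerFun H x (1 : 𝕜))]
    · intro x
      refine Metric.equicontinuousAt_of_continuity_modulus
        (fun y => ‖RKHS.kerFun H x (1 : 𝕜) - RKHS.kerFun H y (1 : 𝕜)‖) ?_ _ ?_
      · have : Continuous fun y => ‖RKHS.kerFun H x (1 : 𝕜) - RKHS.kerFun H y (1 : 𝕜)‖ := by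
          fun_prop
        simpa using this.tendsto x
      · refine Filter.Eventually.of_forall ?_
        rintro y ⟨_, h, hh, rfl⟩
        rw [mem_closedBall_zero_iff] at hh
        change dist (h x) (h y) ≤ _
        rw [dist_eq_norm, ← RKHS.inner_kerFun_one_left, ← RKHS.inner_kerFun_one_left y,
          ← inner_sub_left]
        refine (norm_inner_le_norm _ _).trans ?_
        exact mul_le_of_le_one_right (norm_nonneg _) hh
  refine (isCompactOperator_iff_exists_mem_nhds_image_subset_compact _).mpr
    ⟨Metric.closedBall 0 1, Metric.closedBall_mem_nhds _ one_pos, e.symm '' closure A, ?_, ?_⟩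
  · refine hA.image ?_
    exact (ContinuousMap.isometryEquivBoundedOfCompact X 𝕜).symm.continuous
  · rintro _ ⟨h, hh, rfl⟩
    exact ⟨_, subset_closure ⟨h, hh, rfl⟩, e.symm_apply_apply _⟩

end RKHS

/-! ### The factorization of `L_K` and the Hilbert basis of `H` -/

section Mercer

variable {𝕜 : Type*} [RCLike 𝕜] {X : Type*} [MetricSpace X] [CompactSpace X]
  [MeasurableSpace X] [BorelSpace X] {K : X → X → 𝕜}
  {H : Type*} [NormedAddCommGroup H] [InnerProductSpace 𝕜 H] [CompleteSpace H] [RKHS 𝕜 H X 𝕜]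

/-- The inclusion of a reproducing kernel Hilbert space with continuous kernel functions on a
compact space into `L²`. -/
noncomputable def RKHS.toL2 (hk : Continuous fun x : X => RKHS.kerFun H x (1 : 𝕜))
    (ν : Measure X) [IsFiniteMeasure ν] : H →L[𝕜] Lp 𝕜 2 ν :=
  (ContinuousMap.toLp 2 ν 𝕜).comp (RKHS.toContinuousMap hk)

theorem RKHS.coeFn_toL2 (hk : Continuous fun x : X => RKHS.kerFun H x (1 : 𝕜))
    (ν : Measure X) [IsFiniteMeasure ν] (h : H) : RKHS.toL2 hk ν h =ᵐ[ν] (h : X → 𝕜) :=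
  ContinuousMap.coeFn_toLp (p := 2) (𝕜 := 𝕜) ν (RKHS.toContinuousMap hk h)

/-- The adjoint of the inclusion of the reproducing kernel Hilbert space into `L²` is the integral
operator. -/
theorem RKHS.toContinuousMap_adjoint_toL2 (hH : ∀ x y, RKHS.kernel H x y 1 = K x y)
    (hK : Continuous (Function.uncurry K)) (hk : Continuous fun x : X => RKHS.kerFun H x (1 : 𝕜))
    (ν : Measure X) [IsFiniteMeasure ν] (f : Lp 𝕜 2 ν) :
    RKHS.toContinuousMap hk ((RKHS.toL2 hk ν).adjoint f) = integralOperatorC K hK ν f := by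
  ext x
  rw [RKHS.toContinuousMap_apply, ← RKHS.inner_kerFun_one_left,
    ContinuousLinearMap.adjoint_inner_right, L2.inner_def]
  change _ = ∫ t, K x t * f t ∂ν
  refine integral_congr_ae ?_
  filter_upwards [RKHS.coeFn_toL2 hk ν (RKHS.kerFun H x (1 : 𝕜))] with t ht
  -- The conjugate of `K t x` becomes `K x t` by symmetry of the inner product of two kernel
  -- functions.
  rw [ht, RCLike.inner_apply, ← RKHS.inner_kerFun_one_left, inner_conj_symm,
    RKHS.inner_kerFun_one_left, RKHS.kerFun_one_apply hH, mul_comm]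

theorem RKHS.toL2_adjoint_toL2 (hH : ∀ x y, RKHS.kernel H x y 1 = K x y)
    (hK : Continuous (Function.uncurry K)) (hk : Continuous fun x : X => RKHS.kerFun H x (1 : 𝕜))
    (ν : Measure X) [IsFiniteMeasure ν] (f : Lp 𝕜 2 ν) :
    RKHS.toL2 hk ν ((RKHS.toL2 hk ν).adjoint f) = integralOperator K hK ν f := by
  change ContinuousMap.toLp 2 ν 𝕜 (RKHS.toContinuousMap hk _) = _
  rw [RKHS.toContinuousMap_adjoint_toL2 hH hK]
  rfl

theorem RKHS.isCompactOperator_integralOperator (hH : ∀ x y, RKHS.kernel H x y 1 = K x y)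
    (hK : Continuous (Function.uncurry K)) (hk : Continuous fun x : X => RKHS.kerFun H x (1 : 𝕜))
    (ν : Measure X) [IsFiniteMeasure ν] : IsCompactOperator (integralOperator K hK ν) := by
  have h := ((RKHS.isCompactOperator_toContinuousMap hk).clm_comp
    (ContinuousMap.toLp 2 ν 𝕜 : C(X, 𝕜) →L[𝕜] Lp 𝕜 2 ν)).comp_clm (RKHS.toL2 hk ν).adjoint
  have he : (integralOperator K hK ν : Lp 𝕜 2 ν → Lp 𝕜 2 ν) =
      fun f => RKHS.toL2 hk ν ((RKHS.toL2 hk ν).adjoint f) :=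
    funext fun f => (RKHS.toL2_adjoint_toL2 hH hK hk ν f).symm
  rw [he]
  exact h

theorem RKHS.isSymmetric_integralOperator (hH : ∀ x y, RKHS.kernel H x y 1 = K x y)
    (hK : Continuous (Function.uncurry K)) (hk : Continuous fun x : X => RKHS.kerFun H x (1 : 𝕜))
    (ν : Measure X) [IsFiniteMeasure ν] : (integralOperator K hK ν).IsSymmetric := by
  intro f g
  rw [← RKHS.toL2_adjoint_toL2 hH hK hk, ← RKHS.toL2_adjoint_toL2 hH hK hk,
    ← ContinuousLinearMap.adjoint_inner_right, ContinuousLinearMap.adjoint_inner_left]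

/-- If `h = 0` almost everywhere, the open set `{h ≠ 0}` is null; but it lies in the support of `K`,
hence of `ν`, so it is empty. -/
theorem RKHS.toL2_injective (hH : ∀ x y, RKHS.kernel H x y 1 = K x y)
    (hk : Continuous fun x : X => RKHS.kerFun H x (1 : 𝕜))
    {ν : Measure X} [IsFiniteMeasure ν] (hsupp : kernelSupport K ⊆ ν.support) :
    Function.Injective (RKHS.toL2 hk ν) := by
  rw [injective_iff_map_eq_zero]
  intro h hh
  have hae : ∀ᵐ x ∂ν, h x = 0 := by
    filter_upwards [RKHS.coeFn_toL2 hk ν h, Lp.coeFn_zero 𝕜 2 ν] with x hx h0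
    rw [← hx, hh, h0, Pi.zero_apply]
  ext x
  rw [RKHS.coe_zero, Pi.zero_apply]
  by_contra hx
  have hopen : IsOpen {x | h x ≠ 0} := isOpen_ne_fun (RKHS.continuous_coe hk h) continuous_const
  have hxs : x ∈ ν.support := hsupp <| by
    by_contra hxs
    exact hx (RKHS.apply_eq_zero_of_notMem_kernelSupport hH hxs h)
  exact ((Measure.mem_support_iff_forall x).mp hxs _ (hopen.mem_nhds hx)).ne' hae

/-- The functions `√(lam n) • φ n` form a Hilbert basis of the reproducing kernel Hilbert space. -/
theorem IsMercerEigensystem.exists_hilbertBasis (hH : ∀ x y, RKHS.kernel H x y 1 = K x y)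
    {hK : Continuous (Function.uncurry K)} (hk : Continuous fun x : X => RKHS.kerFun H x (1 : 𝕜))
    {ν : Measure X} [IsFiniteMeasure ν] (hsupp : kernelSupport K ⊆ ν.support)
    {N : ℕ∞} {lam : {n : ℕ // (n : ℕ∞) < N} → ℝ} {φ : {n : ℕ // (n : ℕ∞) < N} → C(X, 𝕜)}
    (hφ : IsMercerEigensystem K hK ν N lam φ) :
    ∃ b : HilbertBasis {n : ℕ // (n : ℕ∞) < N} 𝕜 H,
      ∀ n, RKHS.toContinuousMap hk (b n) = ((√(lam n) : ℝ) : 𝕜) • φ n := by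
  classical
  set J := RKHS.toL2 hk ν
  set Φ := fun n => ContinuousMap.toLp 2 ν 𝕜 (φ n)
  have hs (n) : ((√(lam n) : ℝ) : 𝕜) ≠ 0 := by
    exact_mod_cast (Real.sqrt_pos.mpr (hφ.pos n)).ne'
  have hss (n) : ((lam n : ℝ) : 𝕜) = ((√(lam n) : ℝ) : 𝕜) * ((√(lam n) : ℝ) : 𝕜) := by
    rw [← RCLike.ofReal_mul, Real.mul_self_sqrt (hφ.pos n).le]
  have hJJ (n) : J (J.adjoint (Φ n)) = ((lam n : ℝ) : 𝕜) • Φ n := by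
    rw [RKHS.toL2_adjoint_toL2 hH hK hk]
    change ContinuousMap.toLp 2 ν 𝕜 (integralOperatorC K hK ν (ContinuousMap.toLp 2 ν 𝕜 (φ n))) = _
    rw [hφ.eigen, map_smul]
  let v (n) : H := ((√(lam n) : ℝ) : 𝕜)⁻¹ • J.adjoint (Φ n)
  have hv : Orthonormal 𝕜 v := by
    rw [orthonormal_iff_ite]
    intro i j
    rw [inner_smul_left, inner_smul_right, ContinuousLinearMap.adjoint_inner_left, hJJ,
      inner_smul_right, orthonormal_iff_ite.mp hφ.orthonormal i j, map_inv₀, RCLike.conj_ofReal]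
    split_ifs with hij
    · subst hij
      rw [hss]
      field_simp [hs i]
    · simp
  have hbot : (Submodule.span 𝕜 (range v))ᗮ = ⊥ := by
    rw [Submodule.eq_bot_iff]
    intro h hh
    have hΦ (n) : ⟪Φ n, J h⟫_𝕜 = 0 := by
      have h0 : ⟪v n, h⟫_𝕜 = 0 :=
        (Submodule.mem_orthogonal _ _).mp hh _ (Submodule.subset_span ⟨n, rfl⟩)
      rw [inner_smul_left, ContinuousLinearMap.adjoint_inner_left] at h0
      exact (mul_eq_zero.mp h0).resolve_left (by simpa using hs n)
    have h1 : integralOperator K hK ν (J h) = 0 :=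
      (RKHS.isCompactOperator_integralOperator hH hK hk ν
        ).apply_eq_zero_of_forall_inner_eigenvector_eq_zero
        (RKHS.isSymmetric_integralOperator hH hK hk ν) hφ.orthonormal
        (fun n => (RKHS.toL2_adjoint_toL2 hH hK hk ν _).symm.trans (hJJ n)) hφ.multiplicity hΦ
    have hinj := RKHS.toL2_injective hH hk hsupp
    rw [← RKHS.toL2_adjoint_toL2 hH hK hk] at h1
    -- Injectivity cancels the outer `J`; then `‖J h‖² = ⟪J* J h, h⟫ = 0`.
    have h2 : J.adjoint (J h) = 0 := hinj (h1.trans (map_zero _).symm)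
    have h3 : J h = 0 := by
      rw [← inner_self_eq_zero (𝕜 := 𝕜), ← ContinuousLinearMap.adjoint_inner_left, h2,
        inner_zero_left]
    exact hinj (h3.trans (map_zero _).symm)
  refine ⟨HilbertBasis.mkOfOrthogonalEqBot hv hbot, fun n => ?_⟩
  rw [HilbertBasis.coe_mkOfOrthogonalEqBot, map_smul, RKHS.toContinuousMap_adjoint_toL2 hH hK,
    hφ.eigen, smul_smul, hss, inv_mul_cancel_left₀ (hs n)]

end Mercer

theorem mainTheorem3 {𝕜 : Type*} [RCLike 𝕜] {X : Type*} [MetricSpace X] [CompactSpace X]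
    [MeasurableSpace X] [BorelSpace X] (K : X → X → 𝕜) (hK : IsMercerKernel K)
    {H : Type*} [NormedAddCommGroup H] [InnerProductSpace 𝕜 H] [CompleteSpace H] [RKHS 𝕜 H X 𝕜]
    (hH : ∀ x y, RKHS.kernel H x y 1 = K x y)
    (ν : Measure X) [IsFiniteMeasure ν] (hsupp : kernelSupport K ⊆ ν.support)
    (N : ℕ∞) (lam : {n : ℕ // (n : ℕ∞) < N} → ℝ) (φ : {n : ℕ // (n : ℕ∞) < N} → C(X, 𝕜))
    (hφ : IsMercerEigensystem K hK.continuous_uncurry ν N lam φ) :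
    -- the elements of `H` are square integrable and are determined by their class in `L²`
    ∃ hmem : ∀ h : H, MemLp (h : X → 𝕜) 2 ν,
      Function.Injective (fun h : H => (hmem h).toLp (h : X → 𝕜)) ∧
      -- the description of `H` as a subset of `L²`
      range (fun h : H => (hmem h).toLp (h : X → 𝕜)) =
        {f : Lp 𝕜 2 ν | ∃ c : {n : ℕ // (n : ℕ∞) < N} → 𝕜,
          HasSum (fun n => c n • ContinuousMap.toLp 2 ν 𝕜 (φ n)) f ∧
          Memℓp (fun n => c n / ((√(lam n) : ℝ) : 𝕜)) 2} ∧
      -- the description of `H` as a set of functions on `X`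
      range (fun h : H => (h : X → 𝕜)) =
        {f : X → 𝕜 | ∃ c : {n : ℕ // (n : ℕ∞) < N} → 𝕜,
          (∀ x, HasSum (fun n => c n * φ n x) (f x)) ∧
          Memℓp (fun n => c n / ((√(lam n) : ℝ) : 𝕜)) 2} ∧
      -- absolute and uniform convergence on `X`
      ∀ (h : H) (c : {n : ℕ // (n : ℕ∞) < N} → 𝕜),
        HasSum (fun n => c n • ContinuousMap.toLp 2 ν 𝕜 (φ n)) ((hmem h).toLp (h : X → 𝕜)) →
        Memℓp (fun n => c n / ((√(lam n) : ℝ) : 𝕜)) 2 →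
        (∀ x, Summable (fun n => ‖c n * φ n x‖)) ∧
        HasSumUniformlyOn (fun n x => c n * φ n x) (h : X → 𝕜) univ := by
  have hk := RKHS.continuous_kerFun_one (H := H) hH hK.continuous_uncurry
  obtain ⟨b, hb⟩ := hφ.exists_hilbertBasis hH hk hsupp
  have hs (n) : ((√(lam n) : ℝ) : 𝕜) ≠ 0 := by
    exact_mod_cast (Real.sqrt_pos.mpr (hφ.pos n)).ne'
  have hmem (h : H) : MemLp (h : X → 𝕜) 2 ν :=
    (memLp_congr_ae (RKHS.coeFn_toL2 hk ν h)).mp (Lp.memLp _)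
  have hJ (h : H) : (hmem h).toLp (h : X → 𝕜) = RKHS.toL2 hk ν h :=
    Lp.ext ((hmem h).coeFn_toLp.trans (RKHS.coeFn_toL2 hk ν h).symm)
  have hinj := RKHS.toL2_injective hH hk hsupp
  -- If `a n` are the coordinates of `h` in the basis `√λ_n φ_n`, its coefficients along `φ_n` are
  -- `a n * √λ_n`.
  have hcoef (h : H) : Memℓp (fun n => b.repr h n * ((√(lam n) : ℝ) : 𝕜) /
      ((√(lam n) : ℝ) : 𝕜)) 2 := by
    simp_rw [mul_div_cancel_right₀ _ (hs _)]
    exact lp.memℓp (b.repr h)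
  have hterm (c : {n : ℕ // (n : ℕ∞) < N} → 𝕜) (n) :
      RKHS.toContinuousMap hk ((c n / ((√(lam n) : ℝ) : 𝕜)) • b n) = c n • φ n := by
    rw [map_smul, hb, smul_smul, div_mul_cancel₀ _ (hs n)]
  have hexp (c : {n : ℕ // (n : ℕ∞) < N} → 𝕜)
      (hc : Memℓp (fun n => c n / ((√(lam n) : ℝ) : 𝕜)) 2) :
      ∃ h : H, HasSum (fun n => (c n / ((√(lam n) : ℝ) : 𝕜)) • b n) h :=
    ⟨_, b.hasSum_repr_symm ⟨_, hc⟩⟩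
  have hrepr (h : H) : HasSum (fun n =>
      ((b.repr h n * ((√(lam n) : ℝ) : 𝕜)) / ((√(lam n) : ℝ) : 𝕜)) • b n) h := by
    simp_rw [mul_div_cancel_right₀ _ (hs _)]
    exact b.hasSum_repr h
  have hC {c : {n : ℕ // (n : ℕ∞) < N} → 𝕜} {h : H}
      (hsum : HasSum (fun n => (c n / ((√(lam n) : ℝ) : 𝕜)) • b n) h) :
      HasSum (fun n => c n • φ n) (RKHS.toContinuousMap hk h) := by
    simpa only [hterm] using hsum.mapL (RKHS.toContinuousMap hk)
  have hL2 {c : {n : ℕ // (n : ℕ∞) < N} → 𝕜} {h : H}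
      (hsum : HasSum (fun n => (c n / ((√(lam n) : ℝ) : 𝕜)) • b n) h) :
      HasSum (fun n => c n • ContinuousMap.toLp 2 ν 𝕜 (φ n)) (RKHS.toL2 hk ν h) := by
    have hsum' := (hC hsum).mapL (ContinuousMap.toLp 2 ν 𝕜 : C(X, 𝕜) →L[𝕜] Lp 𝕜 2 ν)
    simp_rw [map_smul] at hsum'
    exact hsum'
  have hpt {c : {n : ℕ // (n : ℕ∞) < N} → 𝕜} {h : H}
      (hsum : HasSum (fun n => (c n / ((√(lam n) : ℝ) : 𝕜)) • b n) h) (x : X) :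
      HasSum (fun n => c n * φ n x) (h x) :=
    (hC hsum).mapL (ContinuousMap.evalCLM 𝕜 x)
  refine ⟨hmem, ?_, ?_, ?_, ?_⟩
  · simpa only [hJ] using hinj
  · simp only [hJ]
    ext f
    constructor
    · rintro ⟨h, rfl⟩
      exact ⟨_, hL2 (hrepr h), hcoef h⟩
    · rintro ⟨c, hf, hc⟩
      obtain ⟨h, hh⟩ := hexp c hc
      exact ⟨h, (hL2 hh).unique hf⟩
  · ext f
    constructor
    · rintro ⟨h, rfl⟩
      exact ⟨_, hpt (hrepr h), hcoef h⟩
    · rintro ⟨c, hf, hc⟩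
      obtain ⟨h, hh⟩ := hexp c hc
      exact ⟨h, funext fun x => (hpt hh x).unique (hf x)⟩
  · intro h c hf hc
    obtain ⟨h', hh⟩ := hexp c hc
    rw [hJ] at hf
    -- The given `c` also defines an element of `H`; having the same `L²` class, it is `h`.
    obtain rfl : h' = h := hinj ((hL2 hh).unique hf)
    -- Unconditional summability of scalars is absolute; uniformity is convergence in `C(X)`.
    refine ⟨fun x => (hpt hh x).summable.norm, ?_⟩
    rw [hasSumUniformlyOn_iff_tendstoUniformlyOn, tendstoUniformlyOn_univ]
    have hunif : TendstoUniformly (fun s x => (∑ n ∈ s, c n • φ n : C(X, 𝕜)) x)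
        (RKHS.toContinuousMap hk h') Filter.atTop :=
      ContinuousMap.tendsto_iff_tendstoUniformly.mp (hC hh)
    convert hunif using 2 with s
    · ext x
      simp
    · rfl
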